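/- **Proposition 2.11.** Notation: $\|\cdot\|$ is the Euclidean norm, $\mathrm{B}_r(\xi)$ and $\bar{\mathrm{B}}_r(\xi)$ are open and closed balls, $\bar\Xi$ and $\partial\Xi$ are the closure and the boundary of $\Xi$. An open domain is an open connected nonempty set. A real function on $\Xi\subseteq\mathbb{R}^n$ is proper if the preimage (in $\Xi$) of every compact subset of $\mathbb{R}$ is compact; a function $\varphi$ on a set $\Xi\ni 0$ is positive definite if $\varphi(0)=0$ and $\varphi(\xi)>0$ for $\xi\in\Xi\setminus\{0\}$. For $x$ in the interior of the domain of a real function $\varphi$, its lower Dini derivative is $$\partial^-\varphi(x;v)=\liminf_{w\to v,\ t\to+0}\frac{\varphi(x+tw)-\varphi(x)}{t}\in[-\infty,+\infty].$$ The proximal normal cone $\mathrm{N}_{\mathrm P}(x;\Xi)$ to $\Xi$ at $x\in\Xi$ is the set of all vectors $t(z-x)$ with $t\geqslant 0$ and $z\in\mathbb{R}^n$ such that $\|z-x\|\leqslant\|z-y\|$ for all $y\in\Xi$. *Control system.* Consider $\dot x(t)=f(x(t),u(t))$, $x(0)=x_0\in G$, where the controls $u(\cdot)$ are the locally essentially bounded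 functions from $[0,+\infty)$ to $U$. Suppose that: 1. $U\subset\mathbb{R}^m$ is compact, $G,G_1\subseteq\mathbb{R}^n$ are open domains, $\bar G\subseteq G_1$, and $0\in G$; 2. $f\colon G_1\times U\to\mathbb{R}^n$ is continuous; 3. every Carathéodory solution in $G_1$ of the system on an interval $[0,T)$, $0<T\leqslant+\infty$, with $x_0\in G$ stays in $G$; 4. for every $R>0$ there is $C_{1,R}>0$ with $\|f(x,u)-f(x',u)\|\leqslant C_{1,R}\|x-x'\|$ for all $x,x'\in\bar{\mathrm{B}}_R(0)\cap\bar G$ and $u\in U$; 5. there are a continuously differentiable proper function $Y\colon G_1\to[0,+\infty)$ and a constant $C_2>0$ with $\langle \mathrm{D}Y(x),f(x,u)\rangle\leqslant C_2Y(x)$ for all $x\in G_1$, $u\in U$; 6. the set $\{f(x,u)\colon u\in U\}$ is convex for every $x\in\bar G$. *Local control Lyapunov function.* Suppose further that: 1. $\Omega\subseteq G$ is an open domain and $0\in\Omega$; 2. $V_{\mathrm{loc}}\colon\bar\Omega\to[0,+\infty)$ is continuous, proper and positive definite, and there is a continuous positive definite function $W_{\mathrm{loc}}\colon\Omega\to[0,+\infty)$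 such that $\inf_{u\in U}\partial^-V_{\mathrm{loc}}(x;f(x,u))\leqslant-W_{\mathrm{loc}}(x)$ for all $x\in\Omega$; 3. $V_{\mathrm{loc}}$ is locally Lipschitz continuous in $\Omega$; 4. $c>0$ is such that $\{x\in\bar\Omega\colon V_{\mathrm{loc}}(x)<c\}$ is an open domain in $\mathbb{R}^n$ whose closure is $\Omega_c=\{x\in\bar\Omega\colon V_{\mathrm{loc}}(x)\leqslant c\}$; there is $C_3>0$ with $\Omega_c+\mathrm{B}_{C_3}(0)\subseteq\Omega$; the boundary $\partial\Omega_c$ coincides with $l_c=\{x\in\bar\Omega\colon V_{\mathrm{loc}}(x)=c\}$ and is connected and nonempty; 5. $\lim_{\varepsilon\to+0}\sup\{\|x\|\colon x\in\bar\Omega,\ V_{\mathrm{loc}}(x)\leqslant\varepsilon\}=0$. Then there exists a constant $C_4>0$ such that, for every $x\in l_c$ and every $\nu\in\mathrm{N}_{\mathrm P}(x;\Omega_c)$ with $\|\nu\|=1$, the minimum below is attained and $$\min_{u\in U}\,\langle\nu,f(x,u)\rangle\leqslant-C_4 .$$ That is, the Petrov condition holds for the right-hand side of the system on $l_c=\partial\Omega_c$.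 -/

import Mathlib

open Set Filter Topology MeasureTheory
open scoped Pointwise

noncomputable section

namespace ExitTimeCLF

/-- An open domain: an open connected (in particular nonempty) set. -/
def IsOpenDomain {E : Type*} [TopologicalSpace E] (D : Set E) : Prop :=
  IsOpen D ∧ IsConnected D

/-- A real function on the set `D` (given as a function on the whole space, only its values on `D`
matter) is proper if the preimage in `D` of every compact set of reals is compact. -/
def IsProperOn {E : Type*} [TopologicalSpace E] (φ : E → ℝ) (D : Set E) : Prop :=
  ∀ M : Set ℝ, IsCompact M → IsCompact {x | x ∈ D ∧ φ x ∈ M}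

/-- Positive definiteness of a function on a set `D` containing the origin. -/
def IsPosDefOn {E : Type*} [Zero E] (φ : E → ℝ) (D : Set E) : Prop :=
  φ 0 = 0 ∧ ∀ x ∈ D, x ≠ 0 → 0 < φ x

/-- The lower Dini derivative (directional subderivate) of `φ` at `x` in the direction `v`,
`liminf (φ (x + t w) - φ x) / t` as `w → v` and `t → +0`, with values in `[-∞, +∞]`. -/
def lowerDini {E : Type*} [NormedAddCommGroup E] [NormedSpace ℝ E]
    (φ : E → ℝ) (x v : E) : EReal :=
  liminf (fun p : E × ℝ => (((φ (x + p.2 • p.1) - φ x) / p.2 : ℝ) : EReal)) (𝓝 v ×ˢ 𝓝[>] (0 : ℝ))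

/-- The proximal normal cone to `S` at a point `x ∈ S`: all nonnegative multiples `t • (z - x)`,
where `z` is a point of the space whose distance to `S` is attained at `x`. -/
def proximalNormalCone {E : Type*} [NormedAddCommGroup E] [InnerProductSpace ℝ E]
    (x : E) (S : Set E) : Set E :=
  {ν | ∃ z : E, ∃ t : ℝ, (∀ y ∈ S, ‖z - x‖ ≤ ‖z - y‖) ∧ 0 ≤ t ∧ ν = t • (z - x)}

/-- Admissible controls: locally essentially bounded functions from `[0, +∞)` to `U`. -/
def IsControl {F : Type*} [NormedAddCommGroup F] (U : Set F) (u : ℝ → F) : Prop :=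
  (∀ T : ℝ, MemLp u ⊤ (volume.restrict (Icc 0 T))) ∧ ∀ t : ℝ, 0 ≤ t → u t ∈ U

/-- `x` is a (Carathéodory) trajectory of `x' = f (x, u)` with `x 0 = x₀` on `[0, T)`,
`0 < T ≤ +∞`. The right-hand side is only defined for states in `G₁`. -/
structure IsTrajectory {E F : Type*} [NormedAddCommGroup E] [NormedSpace ℝ E]
    (f : E → F → E) (G₁ : Set E) (x₀ : E) (u : ℝ → F) (T : EReal) (x : ℝ → E) : Prop where
  pos : 0 < T
  mem_domain : ∀ t : ℝ, 0 ≤ t → (t : EReal) < T → x t ∈ G₁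
  integrable : ∀ t : ℝ, 0 ≤ t → (t : EReal) < T →
    IntervalIntegrable (fun s => f (x s) (u s)) volume 0 t
  eq_integral : ∀ t : ℝ, 0 ≤ t → (t : EReal) < T →
    x t = x₀ + ∫ s in (0 : ℝ)..t, f (x s) (u s)

/-- The basic conditions on the control system `x' = f (x, u)`, `x 0 ∈ G`, `u ∈ U`. -/
structure IsRegularSystem {n m : ℕ}
    (U : Set (EuclideanSpace ℝ (Fin m))) (G G₁ : Set (EuclideanSpace ℝ (Fin n)))
    (f : EuclideanSpace ℝ (Fin n) → EuclideanSpace ℝ (Fin m) → EuclideanSpace ℝ (Fin n)) :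
    Prop where
  isCompact_controls : IsCompact U
  isOpenDomain : IsOpenDomain G
  isOpenDomain' : IsOpenDomain G₁
  closure_subset : closure G ⊆ G₁
  zero_mem : 0 ∈ G
  continuousOn : ContinuousOn
    (fun p : EuclideanSpace ℝ (Fin n) × EuclideanSpace ℝ (Fin m) => f p.1 p.2) (G₁ ×ˢ U)
  /-- `G` is strongly invariant. -/
  strongly_invariant : ∀ x₀ ∈ G, ∀ u : ℝ → EuclideanSpace ℝ (Fin m), IsControl U u →
    ∀ (T : EReal) (x : ℝ → EuclideanSpace ℝ (Fin n)), IsTrajectory f G₁ x₀ u T x →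
      ∀ t : ℝ, 0 ≤ t → (t : EReal) < T → x t ∈ G
  lipschitz : ∀ R : ℝ, 0 < R → ∃ C₁ : ℝ, 0 < C₁ ∧
    ∀ x ∈ Metric.closedBall 0 R ∩ closure G, ∀ x' ∈ Metric.closedBall 0 R ∩ closure G,
      ∀ u ∈ U, ‖f x u - f x' u‖ ≤ C₁ * ‖x - x'‖
  forward_complete : ∃ (Y : EuclideanSpace ℝ (Fin n) → ℝ) (C₂ : ℝ),
    ContDiffOn ℝ 1 Y G₁ ∧ (∀ x ∈ G₁, 0 ≤ Y x) ∧ IsProperOn Y G₁ ∧ 0 < C₂ ∧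
      ∀ x ∈ G₁, ∀ u ∈ U, fderiv ℝ Y x (f x u) ≤ C₂ * Y x

/-- The sets of admissible velocities are convex. -/
def HasConvexVelocities {n m : ℕ}
    (U : Set (EuclideanSpace ℝ (Fin m))) (G : Set (EuclideanSpace ℝ (Fin n)))
    (f : EuclideanSpace ℝ (Fin n) → EuclideanSpace ℝ (Fin m) → EuclideanSpace ℝ (Fin n)) : Prop :=
  ∀ x ∈ closure G, Convex ℝ (f x '' U)

/-- The sublevel set `Ω_c` of a function `V` on the closure of `Ω`. -/
def sublevel {E : Type*} [TopologicalSpace E] (Ω : Set E) (V : E → ℝ) (c : ℝ) : Set E :=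
  {x | x ∈ closure Ω ∧ V x ≤ c}

/-- The level set `l_c` of a function `V` on the closure of `Ω`. -/
def level {E : Type*} [TopologicalSpace E] (Ω : Set E) (V : E → ℝ) (c : ℝ) : Set E :=
  {x | x ∈ closure Ω ∧ V x = c}

/-- The conditions on the local control Lyapunov function `V` on the closure of `Ω` and on the
level `c`. No smoothness of the level set is required. -/
structure IsLocalCLF {n m : ℕ}
    (U : Set (EuclideanSpace ℝ (Fin m))) (G : Set (EuclideanSpace ℝ (Fin n)))
    (f : EuclideanSpace ℝ (Fin n) → EuclideanSpace ℝ (Fin m) → EuclideanSpace ℝ (Fin n))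
    (Ω : Set (EuclideanSpace ℝ (Fin n))) (V : EuclideanSpace ℝ (Fin n) → ℝ) (c : ℝ) : Prop where
  subset : Ω ⊆ G
  isOpenDomain : IsOpenDomain Ω
  zero_mem : 0 ∈ Ω
  nonneg : ∀ x ∈ closure Ω, 0 ≤ V x
  continuousOn : ContinuousOn V (closure Ω)
  proper : IsProperOn V (closure Ω)
  posDef : IsPosDefOn V (closure Ω)
  /-- The infinitesimal decrease condition in terms of lower Dini derivatives. -/
  decrease : ∃ W : EuclideanSpace ℝ (Fin n) → ℝ,
    (∀ x ∈ Ω, 0 ≤ W x) ∧ ContinuousOn W Ω ∧ IsPosDefOn W Ω ∧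
      ∀ x ∈ Ω, (⨅ u ∈ U, lowerDini V x (f x u)) ≤ ((-W x : ℝ) : EReal)
  locallyLipschitz : LocallyLipschitzOn Ω V
  level_pos : 0 < c
  strict_sublevel_isOpenDomain : IsOpenDomain {x | x ∈ closure Ω ∧ V x < c}
  closure_strict_sublevel : closure {x | x ∈ closure Ω ∧ V x < c} = sublevel Ω V c
  thickening_subset : ∃ C₃ : ℝ, 0 < C₃ ∧ sublevel Ω V c + Metric.ball 0 C₃ ⊆ Ω
  frontier_eq : frontier (sublevel Ω V c) = level Ω V c
  level_isConnected : IsConnected (level Ω V c)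
  /-- The sublevel sets shrink to the origin. -/
  shrink : Tendsto (fun ε : ℝ => sSup ((fun x => ‖x‖) '' sublevel Ω V ε)) (𝓝[>] 0) (𝓝 0)

end ExitTimeCLF

end

/-! Some velocity makes `Vloc` drop at a rate of almost `W`. If `Vloc` is `K`-Lipschitz, a point
reached along that velocity in time `t` can be pushed a further `t * δ` along the normal `ν` and
stay in the sublevel set, as long as `K * δ` is below the rate. A proximal normal admits only
second-order outward displacement within the set, so `t * (⟪ν, v⟫ + δ)` is at most `O(t ^ 2)`, and
`⟪ν, v⟫ ≤ -δ`. Since `W` is positive and continuous on the compact level set and `K` is locally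
uniform, finitely many local values of `δ` give a uniform constant. -/

open ExitTimeCLF in
/-- The quadratic inequality that characterizes proximal normals. -/
theorem inner_le_of_mem_proximalNormalCone {E : Type*} [NormedAddCommGroup E]
    [InnerProductSpace ℝ E] {S : Set E} {x ν : E} (hν : ν ∈ proximalNormalCone x S) :
    ∃ σ : ℝ, ∀ y ∈ S, inner ℝ ν (y - x) ≤ σ * ‖y - x‖ ^ 2 := by
  obtain ⟨z, t, hz, ht, rfl⟩ := hν
  refine ⟨t / 2, fun y hy => ?_⟩
  have h1 : ‖z - x‖ ^ 2 ≤ ‖z - y‖ ^ 2 := pow_le_pow_left₀ (norm_nonneg _) (hz y hy) 2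
  have h2 : ‖z - y‖ ^ 2 = ‖z - x‖ ^ 2 - 2 * inner ℝ (z - x) (y - x) + ‖y - x‖ ^ 2 := by
    rw [← norm_sub_sq_real]
    congr 2
    abel
  rw [real_inner_smul_left]
  nlinarith

open ExitTimeCLF in
/-- If a function that is `K`-Lipschitz near `x` decreases at a rate faster than `K * δ` along `v`,
then `v` has inner product at most `-δ` with every unit proximal normal `ν` at `x` to a set that
contains the local sublevel set of the function. -/
theorem inner_le_neg_of_lowerDini_lt {E : Type*} [NormedAddCommGroup E]
    [InnerProductSpace ℝ E] {φ : E → ℝ} {S s : Set E} {x v ν : E} {K : NNReal} {δ : ℝ}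
    (hs : s ∈ 𝓝 x) (hK : LipschitzOnWith K φ s) (hS : ∀ y ∈ s, φ y ≤ φ x → y ∈ S)
    (hδ : 0 ≤ δ) (hD : lowerDini φ x v < ((-(K * δ) : ℝ) : EReal))
    (hν : ν ∈ proximalNormalCone x S) (hν1 : ‖ν‖ = 1) :
    inner ℝ ν v ≤ -δ := by
  obtain ⟨σ, hσ⟩ := inner_le_of_mem_proximalNormalCone hν
  by_contra! hlt
  have hle : 𝓝 v ×ˢ 𝓝[>] (0 : ℝ) ≤ 𝓝 (v, (0 : ℝ)) := by
    rw [nhds_prod_eq]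
    exact prod_mono le_rfl nhdsWithin_le_nhds
  have hpos : ∀ᶠ p : E × ℝ in 𝓝 v ×ˢ 𝓝[>] (0 : ℝ), 0 < p.2 :=
    tendsto_snd.eventually self_mem_nhdsWithin
  have hmem : ∀ᶠ p : E × ℝ in 𝓝 v ×ˢ 𝓝[>] (0 : ℝ), x + p.2 • p.1 ∈ s := by
    refine hle (ContinuousAt.eventually_mem (by fun_prop) ?_)
    simpa using hs
  have hmem' : ∀ᶠ p : E × ℝ in 𝓝 v ×ˢ 𝓝[>] (0 : ℝ), x + p.2 • (p.1 + δ • ν) ∈ s := by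
    refine hle (ContinuousAt.eventually_mem (by fun_prop) ?_)
    simpa using hs
  -- At `(v, 0)` the left side vanishes, while the right side is positive by the negated conclusion.
  have hin : ∀ᶠ p : E × ℝ in 𝓝 v ×ˢ 𝓝[>] (0 : ℝ),
      σ * p.2 * ‖p.1 + δ • ν‖ ^ 2 < inner ℝ ν p.1 + δ := by
    refine hle (ContinuousAt.eventually_lt (by fun_prop) (by fun_prop) ?_)
    simp only [mul_zero, zero_mul]
    linarith
  have hfreq := frequently_lt_of_liminf_lt (h := hD)
  obtain ⟨⟨w, t⟩, hq, ht, h1, h2, h3⟩ :=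
    (hfreq.and_eventually (hpos.and (hmem.and (hmem'.and hin)))).exists
  simp only at ht h1 h2 h3 hq
  rw [EReal.coe_lt_coe_iff, div_lt_iff₀ ht] at hq
  have hlip := hK.dist_le_mul _ h2 _ h1
  have hd : dist (x + t • (w + δ • ν)) (x + t • w) = t * δ := by
    rw [dist_eq_norm, show x + t • (w + δ • ν) - (x + t • w) = (t * δ) • ν by module, norm_smul,
      hν1, mul_one, Real.norm_of_nonneg (mul_nonneg ht.le hδ)]
  rw [hd, Real.dist_eq] at hlip
  -- The push along `ν` costs at most `K * (t * δ)`, less than the decrease already gained, so the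
  -- pushed point is still in `S`.
  have hy := hσ _ (hS _ h2 (by nlinarith [le_abs_self (φ (x + t • (w + δ • ν)) - φ (x + t • w))]))
  rw [add_sub_cancel_left, real_inner_smul_right, inner_add_right, real_inner_smul_right,
    real_inner_self_eq_norm_sq, hν1, norm_smul, Real.norm_of_nonneg ht.le] at hy
  have := mul_lt_mul_of_pos_left h3 ht
  nlinarith

theorem proposition2p11 {n m : ℕ}
    (U : Set (EuclideanSpace ℝ (Fin m))) (G G₁ : Set (EuclideanSpace ℝ (Fin n)))
    (f : EuclideanSpace ℝ (Fin n) → EuclideanSpace ℝ (Fin m) → EuclideanSpace ℝ (Fin n))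
    (hsys : ExitTimeCLF.IsRegularSystem U G G₁ f)
    (hconv : ExitTimeCLF.HasConvexVelocities U G f)
    (Ω : Set (EuclideanSpace ℝ (Fin n))) (Vloc : EuclideanSpace ℝ (Fin n) → ℝ) (c : ℝ)
    (hV : ExitTimeCLF.IsLocalCLF U G f Ω Vloc c) :
    ∃ C₄ : ℝ, 0 < C₄ ∧
      ∀ x ∈ ExitTimeCLF.level Ω Vloc c,
        ∀ ν ∈ ExitTimeCLF.proximalNormalCone x (ExitTimeCLF.sublevel Ω Vloc c), ‖ν‖ = 1 →
          ∃ u₀ ∈ U, IsMinOn (fun u => inner ℝ ν (f x u)) U u₀ ∧ inner ℝ ν (f x u₀) ≤ -C₄ := by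
  obtain ⟨W, -, hWc, hWpos, hdec⟩ := hV.decrease
  have hcomp : IsCompact (ExitTimeCLF.level Ω Vloc c) := hV.proper {c} isCompact_singleton
  have hΩ : IsOpen Ω := hV.isOpenDomain.1
  have hsub : ExitTimeCLF.level Ω Vloc c ⊆ Ω := by
    obtain ⟨C₃, hC₃, h⟩ := hV.thickening_subset
    intro x hx
    have := h (Set.add_mem_add (⟨hx.1, hx.2.le⟩ : x ∈ ExitTimeCLF.sublevel Ω Vloc c)
      (Metric.mem_ball_self hC₃))
    simpa using this
  -- The extra hypotheses `x ∈ Ω` and `Vloc x = c` are there because compactness induction ranges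
  -- over arbitrary sets, not only subsets of the level set.
  suffices H : ∃ C : ℝ, 0 < C ∧ ∀ x ∈ ExitTimeCLF.level Ω Vloc c, x ∈ Ω →
      Vloc x = c → ∀ ν ∈ ExitTimeCLF.proximalNormalCone x (ExitTimeCLF.sublevel Ω Vloc c),
        ‖ν‖ = 1 → ∃ u ∈ U, inner ℝ ν (f x u) ≤ -C by
    obtain ⟨C, hC, h⟩ := H
    refine ⟨C, hC, fun x hx ν hν hν1 => ?_⟩
    obtain ⟨u, hu, hle⟩ := h x hx (hsub hx) hx.2 ν hν hν1
    have hxG : x ∈ G₁ := hsys.closure_subset (subset_closure (hV.subset (hsub hx)))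
    have hf : ContinuousOn (fun u => f x u) U :=
      hsys.continuousOn.comp (f := fun u => (x, u)) (by fun_prop) fun u hu => ⟨hxG, hu⟩
    obtain ⟨u₀, hu₀, hmin⟩ := hsys.isCompact_controls.exists_isMinOn ⟨u, hu⟩
      (f := fun u => inner ℝ ν (f x u)) (continuousOn_const.inner hf)
    exact ⟨u₀, hu₀, hmin, (hmin hu).trans hle⟩
  refine hcomp.induction_on (p := fun s => ∃ C : ℝ, 0 < C ∧ ∀ x ∈ s, x ∈ Ω → Vloc x = c →
      ∀ ν ∈ ExitTimeCLF.proximalNormalCone x (ExitTimeCLF.sublevel Ω Vloc c),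
        ‖ν‖ = 1 → ∃ u ∈ U, inner ℝ ν (f x u) ≤ -C) ?_ ?_ ?_ ?_
  · exact ⟨1, one_pos, fun x hx => hx.elim⟩
  · rintro s t hst ⟨C, hC, h⟩
    exact ⟨C, hC, fun x hx => h x (hst hx)⟩
  · rintro s t ⟨C, hC, h⟩ ⟨C', hC', h'⟩
    refine ⟨min C C', lt_min hC hC', ?_⟩
    rintro x (hx | hx) hxΩ hxc ν hν hν1
    · obtain ⟨u, hu, hle⟩ := h x hx hxΩ hxc ν hν hν1
      exact ⟨u, hu, hle.trans (neg_le_neg (min_le_left _ _))⟩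
    · obtain ⟨u, hu, hle⟩ := h' x hx hxΩ hxc ν hν hν1
      exact ⟨u, hu, hle.trans (neg_le_neg (min_le_right _ _))⟩
  intro a ha
  have haΩ := hsub ha
  have ha0 : a ≠ 0 := by
    rintro rfl
    exact hV.level_pos.ne (hV.posDef.1.symm.trans ha.2)
  have hWa : 0 < W a := hWpos.2 a haΩ ha0
  obtain ⟨K, t, ht, hK⟩ := hV.locallyLipschitz haΩ
  rw [hΩ.nhdsWithin_eq haΩ] at ht
  have hWn : ∀ᶠ x in 𝓝 a, W a / 2 < W x :=
    (hWc.continuousAt (hΩ.mem_nhds haΩ)).eventually (lt_mem_nhds (half_lt_self hWa))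
  have hK1 : (0 : ℝ) < K + 1 := by positivity
  -- Asking for `t ∩ Ω ∈ 𝓝 x` gives every nearby `x` a neighbourhood with the same constant `K`. The
  -- `+ 1` guards against `K = 0`.
  refine ⟨{x | t ∩ Ω ∈ 𝓝 x ∧ W a / 2 < W x}, mem_nhdsWithin_of_mem_nhds
    ((eventually_mem_nhds_iff.2 (inter_mem ht (hΩ.mem_nhds haΩ))).and hWn),
    W a / 2 / (K + 1), by positivity, ?_⟩
  rintro x ⟨hx, hWx⟩ hxΩ hxc ν hν hν1
  -- A strict bound on the infimum yields an actual control, though the infimum need not be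
  -- attained.
  have hlt : (⨅ u ∈ U, ExitTimeCLF.lowerDini Vloc x (f x u)) <
      ((-(K * (W a / 2 / (K + 1))) : ℝ) : EReal) := by
    refine (hdec x hxΩ).trans_lt (EReal.coe_lt_coe_iff.2 (neg_lt_neg (lt_of_le_of_lt ?_ hWx)))
    rw [mul_div_assoc', div_le_iff₀ hK1]
    nlinarith
  simp only [iInf_lt_iff] at hlt
  obtain ⟨u, hu, hD⟩ := hlt
  exact ⟨u, hu, inner_le_neg_of_lowerDini_lt (S := ExitTimeCLF.sublevel Ω Vloc c) hx
    (hK.mono inter_subset_left)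
    (fun y hy hyx => ⟨subset_closure hy.2, hyx.trans hxc.le⟩) (by positivity) hD hν hν1⟩
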